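/- Let $N\in\mathbb N$, $0<s<1$, $2s<N$, $2_s^*=\frac{2N}{N-2s}$, and let $2<q<\min(r,2_s^*)$. Let $$D^s(\mathbb R^N)=\Big\{u\in L^{2_s^*}(\mathbb R^N):\ \frac{|u(x)-u(y)|}{|x-y|^{N/2+s}}\in L^2(\mathbb R^N\times\mathbb R^N)\Big\}.$$ Let $f,g:\mathbb R^N\times\mathbb R\to\mathbb R$ be Carathéodory functions (measurable in $x$ for every $t$, continuous in $t$ for almost all $x$) such that: (F) $|f(x,t)|\le m(x)|t|^{q-1}$ for almost all $x\in\mathbb R^N$ and all $t\in\mathbb R$, where $m$ is a positive function with $m\in L^{\frac{2_s^*}{2_s^*-1}}(\mathbb R^N)\cap L^{\frac{2_s^*}{2_s^*-q}+\delta}(\mathbb R^N)$ for some $\delta>0$; (G) either $1<r<2_s^*$ and $|g(x,t)|\le h(x)|t|^{r-1}$ for almost all $x\in\mathbb R^N$ and all $t\in\mathbb R$, where $h$ is a positive function with $h\in L^{\frac{2_s^*}{2_s^*-r}}(\mathbb R^N)\cap L^{\frac{2_s^*}{2_s^*-r}+\delta}(\mathbb R^N)$ for some $\delta>0$; or $r=2_s^*$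 and $|g(x,t)|\le h(x)|t|^{2_s^*-1}$ for almost all $x\in\mathbb R^N$ and all $t\in\mathbb R$, where $h\in L^\infty(\mathbb R^N)$, and $g(x,0)=0$ for almost all $x$. Put $F(x,t)=\int_0^t f(x,\xi)\,d\xi$, and suppose that for some $1<\tau<2$, some positive function $\rho\in L^{\frac{2_s^*}{2_s^*-\tau}}(\mathbb R^N)$ and some $M\in\mathbb R$, $$\limsup_{|t|\to\infty}\frac{F(x,t)}{\rho(x)|t|^\tau}\le M\quad\text{uniformly for almost all }x\in\mathbb R^N,\qquad\text{and}\qquad \sup_{v\in D^s(\mathbb R^N)}\int_{\mathbb R^N}F(x,v(x))\,dx>0.$$ Let $\lambda>0$ and $\mu\ge0$, and let $u$ be a weak solution of $(-\Delta)^su=\lambda f(x,u)+\mu g(x,u)$ in $\mathbb R^N$, that is, $u\in D^s(\mathbb R^N)$ and $$\iint_{\mathbb R^{2N}}\frac{[u(x)-u(y)][\varphi(x)-\varphi(y)]}{|x-y|^{N+2s}}\,dx\,dy=\int_{\mathbb R^N}\big(\lambda f(x,u)+\mu g(x,u)\big)\varphi\,dx\quad\text{for all }\varphi\in D^s(\mathbb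 R^N).$$ Then $u\in L^\sigma(\mathbb R^N)$ for all $2_s^*\le\sigma\le\infty$. -/

import Mathlib

open MeasureTheory

namespace FracLap

/-- Euclidean space of dimension `N`. -/
abbrev RN (N : ℕ) : Type := EuclideanSpace ℝ (Fin N)

/-- The fractional critical Sobolev exponent `2N / (N - 2s)`. -/
noncomputable def critExp (N : ℕ) (s : ℝ) : ℝ := 2 * (N : ℝ) / ((N : ℝ) - 2 * s)

/-- The function `u` belongs to the homogeneous fractional Sobolev space `D^s(ℝ^N)`:
it lies in `L^{2N/(N-2s)}(ℝ^N)` and `|u(x) - u(y)| / |x - y|^{N/2 + s}` is square integrable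
on `ℝ^N × ℝ^N`. -/
def MemDs (N : ℕ) (s : ℝ) (u : RN N → ℝ) : Prop :=
  MemLp u (ENNReal.ofReal (critExp N s)) volume ∧
    MemLp (fun p : RN N × RN N => |u p.1 - u p.2| / ‖p.1 - p.2‖ ^ ((N : ℝ) / 2 + s)) 2
      (volume.prod volume)

/-- The bilinear form
`∬ (u(x) - u(y)) (φ(x) - φ(y)) / |x - y|^{N + 2s} dx dy`. -/
noncomputable def gagliardoForm (N : ℕ) (s : ℝ) (u φ : RN N → ℝ) : ℝ :=
  ∫ p : RN N × RN N, (u p.1 - u p.2) * (φ p.1 - φ p.2) / ‖p.1 - p.2‖ ^ ((N : ℝ) + 2 * s)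
    ∂(volume.prod volume)

/-- The function `u` is a weak solution of `(-Δ)^s u = k(x, u)` in `ℝ^N`. -/
def IsWeakSolution (N : ℕ) (s : ℝ) (k : RN N → ℝ → ℝ) (u : RN N → ℝ) : Prop :=
  MemDs N s u ∧
    ∀ φ : RN N → ℝ, MemDs N s φ → gagliardoForm N s u φ = ∫ x, k x (u x) * φ x

/-- Carathéodory functions: Lebesgue measurable in `x` for every `t`, and continuous in `t` for
almost all `x`. -/
def IsCaratheodoryFun (N : ℕ) (f : RN N → ℝ → ℝ) : Prop :=
  (∀ t : ℝ, AEMeasurable (fun x => f x t) volume) ∧ ∀ᵐ x : RN N, Continuous (f x)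

/-- The growth condition on `f`. -/
def GrowthF (N : ℕ) (s q : ℝ) (f : RN N → ℝ → ℝ) : Prop :=
  ∃ m : RN N → ℝ, (∀ᵐ x : RN N, 0 < m x) ∧
    MemLp m (ENNReal.ofReal (critExp N s / (critExp N s - 1))) volume ∧
    (∃ δ : ℝ, 0 < δ ∧
      MemLp m (ENNReal.ofReal (critExp N s / (critExp N s - q) + δ)) volume) ∧
    ∀ᵐ x : RN N, ∀ t : ℝ, |f x t| ≤ m x * |t| ^ (q - 1)

/-- The growth condition on `g`, in the subcritical case `1 < r < 2N/(N-2s)` and in the critical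
case `r = 2N/(N-2s)`. -/
def GrowthG (N : ℕ) (s r : ℝ) (g : RN N → ℝ → ℝ) : Prop :=
  (1 < r ∧ r < critExp N s ∧
    ∃ h : RN N → ℝ, (∀ᵐ x : RN N, 0 < h x) ∧
      MemLp h (ENNReal.ofReal (critExp N s / (critExp N s - r))) volume ∧
      (∃ δ : ℝ, 0 < δ ∧
        MemLp h (ENNReal.ofReal (critExp N s / (critExp N s - r) + δ)) volume) ∧
      ∀ᵐ x : RN N, ∀ t : ℝ, |g x t| ≤ h x * |t| ^ (r - 1)) ∨
  (r = critExp N s ∧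
    (∃ h : RN N → ℝ, MemLp h ⊤ volume ∧
      ∀ᵐ x : RN N, ∀ t : ℝ, |g x t| ≤ h x * |t| ^ (critExp N s - 1)) ∧
    ∀ᵐ x : RN N, g x 0 = 0)

/-- The primitive `F(x, t) = ∫_0^t f(x, ξ) dξ`. -/
noncomputable def primitive {N : ℕ} (f : RN N → ℝ → ℝ) (x : RN N) (t : ℝ) : ℝ :=
  ∫ ξ in (0 : ℝ)..t, f x ξ

/-- `limsup_{|t| → ∞} F(x, t) / (ρ(x) |t|^τ) ≤ M`, uniformly for almost all `x`. -/
def UniformLimsupLE {N : ℕ} (F : RN N → ℝ → ℝ) (ρ : RN N → ℝ) (τ M : ℝ) : Prop :=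
  ∀ ε : ℝ, 0 < ε → ∃ A : ℝ, ∀ᵐ x : RN N, ∀ t : ℝ, A < |t| →
    F x t / (ρ x * |t| ^ τ) ≤ M + ε

end FracLap

namespace FracLap

open Filter Topology

/-! The proof is a De Giorgi iteration on level sets. Write `p` for the critical exponent and `U k`
for the `L^p` norm of `u` restricted to `{|u| > k}`; this tends to zero as `k` grows, because `u ∈
L^p`. The soft threshold `φ` of `u` at height `k` is an admissible test function, and its energy is
at most the form of `u` against `φ` (`gagliardoForm_self_le`). The equation and Hölder's inequality
bound that form by a constant times `(U k ^ (q - 1) + U k ^ (r - 1)) * ‖φ‖_p`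
(`integral_mul_softThreshold_le`), since `φ` lives on `{|u| > k}`.

The fractional Sobolev inequality (`exists_sobolev_const`) bounds `‖φ‖_p ^ 2` by the energy of `φ`,
so dividing by `‖φ‖_p` gives `‖φ‖_p ≤ D * U k ^ (q - 1)` once `U k ≤ 1`. As `U h` is at most `h / (h
- k) * ‖φ‖_p` and `q - 1 > 1`, the recursion is superlinear and forces `U K = 0` at a finite level
(`exists_level_eq_zero`). Hence `|u| ≤ K` almost everywhere, and `u ∈ L^p` gives every larger
exponent. The critical case needs no separate treatment: the smallness comes from `U k`, not from
the weight. -/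

/-! ### The critical exponent and the energy form -/

theorem critExp_pos {N : ℕ} {s : ℝ} (hs0 : 0 < s) (hN : 2 * s < (N : ℝ)) : 0 < critExp N s :=
  div_pos (by linarith) (by linarith)

theorem two_lt_critExp {N : ℕ} {s : ℝ} (hs0 : 0 < s) (hN : 2 * s < (N : ℝ)) :
    2 < critExp N s := by
  unfold critExp
  rw [lt_div_iff₀ (by linarith)]
  linarith

theorem one_sub_two_div_critExp {N : ℕ} {s : ℝ} (hs0 : 0 < s) (hN : 2 * s < (N : ℝ)) :
    1 - 2 / critExp N s = 2 * s / N := by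
  have h1 : (N : ℝ) - 2 * s ≠ 0 := by linarith
  have h2 : (N : ℝ) ≠ 0 := by linarith
  unfold critExp
  field_simp
  ring

theorem rpow_half_sq {a d s : ℝ} (hd : 0 ≤ d) : (d ^ (a / 2 + s)) ^ 2 = d ^ (a + 2 * s) := by
  rw [← Real.rpow_natCast, ← Real.rpow_mul hd]
  congr 1
  push_cast
  ring

theorem integrable_gagliardo_sq {N : ℕ} {s : ℝ} {u : RN N → ℝ} (hu : MemDs N s u) :
    Integrable (fun p : RN N × RN N => (u p.1 - u p.2) ^ 2 / ‖p.1 - p.2‖ ^ ((N : ℝ) + 2 * s))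
      (volume.prod volume) := by
  refine hu.2.integrable_sq.congr (ae_of_all _ fun p => ?_)
  simp only
  rw [div_pow, sq_abs, rpow_half_sq (norm_nonneg _)]

theorem memDs_of_abs_sub_le {N : ℕ} {s : ℝ} {u v : RN N → ℝ} (hu : MemDs N s u)
    (hv : AEStronglyMeasurable v volume) (h1 : ∀ x, |v x| ≤ |u x|)
    (h2 : ∀ x y, |v x - v y| ≤ |u x - u y|) : MemDs N s v := by
  refine ⟨hu.1.mono hv (ae_of_all _ h1), hu.2.mono ?_ (ae_of_all _ fun p => ?_)⟩
  · have h : AEMeasurable (fun p : RN N × RN N => v p.1 - v p.2) (volume.prod volume) :=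
      (hv.comp_fst.sub hv.comp_snd).aemeasurable
    exact (h.norm.div ((by fun_prop :
      Measurable fun p : RN N × RN N => ‖p.1 - p.2‖ ^ ((N : ℝ) / 2 + s)).aemeasurable)).aestronglyMeasurable
  · rw [Real.norm_of_nonneg (by positivity), Real.norm_of_nonneg (by positivity)]
    exact div_le_div_of_nonneg_right (h2 _ _) (by positivity)

/-- The hypothesis compares the two integrands pointwise. The mixed one is integrable as a product
of two `L^2` difference quotients. -/
theorem gagliardoForm_self_le {N : ℕ} {s : ℝ} {u v : RN N → ℝ} (hu : MemDs N s u)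
    (hv : MemDs N s v) (h : ∀ x y, (v x - v y) ^ 2 ≤ (u x - u y) * (v x - v y)) :
    gagliardoForm N s v v ≤ gagliardoForm N s u v := by
  have hi := (hu.2.integrable_mul hv.2 (p := 2) (q := 2))
  unfold gagliardoForm
  refine integral_mono ?_ (hi.congr (ae_of_all _ fun p => ?_)) fun p => ?_
  · exact (integrable_gagliardo_sq hv).congr (ae_of_all _ fun p => by simp only [sq])
  · have h0 : |u p.1 - u p.2| * |v p.1 - v p.2| = (u p.1 - u p.2) * (v p.1 - v p.2) := by
      rw [← abs_mul, abs_of_nonneg ((sq_nonneg _).trans (h _ _))]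
    simp only [Pi.mul_apply]
    rw [div_mul_div_comm, h0, ← sq, rpow_half_sq (norm_nonneg _)]
  · simp only
    refine div_le_div_of_nonneg_right ?_ (by positivity)
    rw [← sq]
    exact h _ _

/-! ### The fractional Sobolev inequality -/

/-- The inner integral of the Gagliardo seminorm. -/
noncomputable def gagliardoInner (N : ℕ) (s : ℝ) (u : RN N → ℝ) (x : RN N) : ENNReal :=
  ∫⁻ y, ENNReal.ofReal ((u x - u y) ^ 2 / ‖x - y‖ ^ ((N : ℝ) + 2 * s))

theorem lintegral_gagliardoInner {N : ℕ} {s : ℝ} {u : RN N → ℝ} (hu : MemDs N s u) :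
    ∫⁻ x, gagliardoInner N s u x = ENNReal.ofReal (gagliardoForm N s u u) := by
  have hi := integrable_gagliardo_sq hu
  have e : gagliardoForm N s u u = ∫ p : RN N × RN N,
      (u p.1 - u p.2) ^ 2 / ‖p.1 - p.2‖ ^ ((N : ℝ) + 2 * s) ∂(volume.prod volume) := by
    simp only [gagliardoForm, sq]
  rw [e, ofReal_integral_eq_lintegral_ofReal hi (ae_of_all _ fun p => by positivity),
    lintegral_prod _ hi.1.aemeasurable.ennreal_ofReal]
  rfl

/-- Integrate `u(x)^2 ≤ 2 (u(x) - u(y))^2 + 2 u(y)^2` over `y` in the ball. In the first term `|x -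
y| ≤ R` brings in the singular kernel; the second is Hölder's inequality, with volume exponent `1 -
2/p = 2s/N`. -/
theorem sq_mul_volume_ball_le {N : ℕ} {s : ℝ} (hs0 : 0 < s) (hN : 2 * s < (N : ℝ))
    {u : RN N → ℝ} (hu : AEStronglyMeasurable u volume) (x : RN N) {R : ℝ} (hR : 0 < R) :
    ENNReal.ofReal (u x ^ 2) * volume (Metric.ball x R) ≤
      2 * (ENNReal.ofReal (R ^ ((N : ℝ) + 2 * s)) * gagliardoInner N s u x) +
      2 * (eLpNorm u (ENNReal.ofReal (critExp N s)) volume ^ 2 *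
        volume (Metric.ball x R) ^ (2 * s / (N : ℝ))) := by
  set B := Metric.ball x R
  have hp := critExp_pos hs0 hN
  have h1 : ∫⁻ y in B, ENNReal.ofReal ((u x - u y) ^ 2) ≤
      ENNReal.ofReal (R ^ ((N : ℝ) + 2 * s)) * gagliardoInner N s u x := by
    calc ∫⁻ y in B, ENNReal.ofReal ((u x - u y) ^ 2)
        ≤ ∫⁻ y in B, ENNReal.ofReal (R ^ ((N : ℝ) + 2 * s)) *
            ENNReal.ofReal ((u x - u y) ^ 2 / ‖x - y‖ ^ ((N : ℝ) + 2 * s)) := by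
          refine setLIntegral_mono' measurableSet_ball fun y hy => ?_
          rw [← ENNReal.ofReal_mul (by positivity)]
          refine ENNReal.ofReal_le_ofReal ?_
          rcases eq_or_ne x y with rfl | hxy
          · simp
          have hd : 0 < ‖x - y‖ := norm_pos_iff.mpr (sub_ne_zero.mpr hxy)
          have hdR : ‖x - y‖ ≤ R := by
            rw [← dist_eq_norm, dist_comm]; exact (Metric.mem_ball.mp hy).le
          rw [← mul_div_assoc, le_div_iff₀ (by positivity), mul_comm]
          gcongr
      _ ≤ ∫⁻ y, ENNReal.ofReal (R ^ ((N : ℝ) + 2 * s)) *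
            ENNReal.ofReal ((u x - u y) ^ 2 / ‖x - y‖ ^ ((N : ℝ) + 2 * s)) :=
          setLIntegral_le_lintegral _ _
      _ = _ := lintegral_const_mul' _ _ ENNReal.ofReal_ne_top
  have h2 : ∫⁻ y in B, ENNReal.ofReal (u y ^ 2) ≤
      eLpNorm u (ENNReal.ofReal (critExp N s)) volume ^ 2 * volume B ^ (2 * s / (N : ℝ)) := by
    have e1 : ∫⁻ y in B, ENNReal.ofReal (u y ^ 2) = eLpNorm u 2 (volume.restrict B) ^ 2 := by
      rw [eLpNorm_eq_lintegral_rpow_enorm_toReal (by simp) (by simp), ← ENNReal.rpow_natCast,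
        ← ENNReal.rpow_mul]
      simp only [ENNReal.toReal_ofNat, Nat.cast_ofNat, one_div, ne_eq, OfNat.ofNat_ne_zero,
        not_false_eq_true, inv_mul_cancel₀, ENNReal.rpow_one, ENNReal.rpow_ofNat]
      refine lintegral_congr fun y => ?_
      rw [Real.enorm_eq_ofReal_abs, ← ENNReal.ofReal_pow (abs_nonneg _), sq_abs]
    have h2p : (2 : ENNReal) ≤ ENNReal.ofReal (critExp N s) := by
      rw [ENNReal.le_ofReal_iff_toReal_le (by simp) hp.le]
      simpa using (two_lt_critExp hs0 hN).le
    have e2 := eLpNorm_le_eLpNorm_mul_rpow_measure_univ h2p (hu.restrict (s := B))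
    rw [e1]
    calc eLpNorm u 2 (volume.restrict B) ^ 2
        ≤ (eLpNorm u (ENNReal.ofReal (critExp N s)) volume *
            volume B ^ ((1 : ℝ) / 2 - 1 / critExp N s)) ^ 2 := by
          refine pow_le_pow_left₀ zero_le (e2.trans ?_) 2
          rw [Measure.restrict_apply_univ, ENNReal.toReal_ofReal hp.le, ENNReal.toReal_ofNat]
          gcongr
          exact Measure.restrict_le_self
      _ = _ := by
          rw [mul_pow]
          congr 1
          rw [← ENNReal.rpow_natCast, ← ENNReal.rpow_mul, ← one_sub_two_div_critExp hs0 hN]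
          congr 1
          push_cast
          ring
  calc ENNReal.ofReal (u x ^ 2) * volume B = ∫⁻ _ in B, ENNReal.ofReal (u x ^ 2) := by
        rw [setLIntegral_const]
    _ ≤ ∫⁻ y in B, (2 * ENNReal.ofReal ((u x - u y) ^ 2) + 2 * ENNReal.ofReal (u y ^ 2)) := by
        refine lintegral_mono fun y => ?_
        have h2' : (2 : ENNReal) = ENNReal.ofReal 2 := by simp
        rw [h2', ← ENNReal.ofReal_mul (by norm_num), ← ENNReal.ofReal_mul (by norm_num),
          ← ENNReal.ofReal_add (by positivity) (by positivity)]
        refine ENNReal.ofReal_le_ofReal ?_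
        nlinarith [sq_nonneg (u x - 2 * u y)]
    _ = 2 * (∫⁻ y in B, ENNReal.ofReal ((u x - u y) ^ 2)) +
          2 * ∫⁻ y in B, ENNReal.ofReal (u y ^ 2) := by
        rw [lintegral_add_right', lintegral_const_mul' _ _ (by simp),
          lintegral_const_mul' _ _ (by simp)]
        exact ((hu.aemeasurable.restrict.pow_const 2).ennreal_ofReal).const_mul 2
    _ ≤ _ := by gcongr

/-- The pointwise inequality behind the fractional Sobolev inequality. -/
theorem exists_abs_rpow_critExp_le (N : ℕ) (s : ℝ) (hs0 : 0 < s) (hN : 2 * s < (N : ℝ)) :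
    ∃ C : ℝ, 0 < C ∧ ∀ u : RN N → ℝ, MemLp u (ENNReal.ofReal (critExp N s)) volume →
      0 < (eLpNorm u (ENNReal.ofReal (critExp N s)) volume).toReal → ∀ x,
      ENNReal.ofReal (|u x| ^ critExp N s) ≤
        ENNReal.ofReal (C * (eLpNorm u (ENNReal.ofReal (critExp N s)) volume).toReal ^
          (critExp N s - 2)) * gagliardoInner N s u x := by
  set p := critExp N s with hpdef
  have hp : 0 < p := critExp_pos hs0 hN
  have hp2 : 2 < p := two_lt_critExp hs0 hN
  have hN0 : (0 : ℝ) < N := by linarith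
  have hps : 2 * s / N = 1 - 2 / p := (one_sub_two_div_critExp hs0 hN).symm
  set ω : ℝ := (volume (Metric.ball (0 : RN N) 1)).toReal with hω
  have hω0 : 0 < ω := ENNReal.toReal_pos (Metric.measure_ball_pos _ _ one_pos).ne'
    measure_ball_lt_top.ne
  refine ⟨4 * (ω⁻¹) ^ (1 + 2 * s / N) * 2 ^ (p - 2), by positivity, fun u hu hA x => ?_⟩
  set A := (eLpNorm u (ENNReal.ofReal p) volume).toReal with hAdef
  have hAe : eLpNorm u (ENNReal.ofReal p) volume = ENNReal.ofReal A :=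
    (ENNReal.ofReal_toReal hu.2.ne).symm
  rcases eq_or_ne (u x) 0 with hux | hux
  · simp [hux, Real.zero_rpow hp.ne']
  rcases eq_or_ne (gagliardoInner N s u x) ⊤ with hG | hG
  · rw [hG, ENNReal.mul_top]
    · exact le_top
    · simp only [ne_eq, ENNReal.ofReal_eq_zero, not_le]; positivity
  set t := |u x| with ht
  have ht0 : 0 < t := abs_pos.mpr hux
  set G := (gagliardoInner N s u x).toReal with hGdef
  have hGe : gagliardoInner N s u x = ENNReal.ofReal G := (ENNReal.ofReal_toReal hG).symm
  have hG0 : 0 ≤ G := ENNReal.toReal_nonneg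
  -- The ball volume `v` is chosen so that the Hölder term `2 A^2 v^(1 - 2/p)` equals `t^2 v / 2`,
  -- half of the left side, and can be absorbed.
  set v : ℝ := (2 * A / t) ^ p with hv
  have hv0 : 0 < v := by positivity
  set R : ℝ := (v / ω) ^ (1 / (N : ℝ)) with hR
  have hR0 : 0 < R := by positivity
  have hvol : volume (Metric.ball x R) = ENNReal.ofReal v := by
    rw [Measure.addHaar_ball_of_pos _ _ hR0, finrank_euclideanSpace_fin,
      ← ENNReal.ofReal_toReal (measure_ball_lt_top (μ := volume) (x := (0 : RN N)) (r := 1)).ne,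
      ← hω, ← ENNReal.ofReal_mul (by positivity), ← Real.rpow_natCast R, hR, ← Real.rpow_mul
      (by positivity), one_div_mul_cancel hN0.ne', Real.rpow_one, div_mul_cancel₀ _ hω0.ne']
  have key := sq_mul_volume_ball_le hs0 hN hu.1 x hR0
  rw [← hpdef, hvol, hAe, hGe, ← ENNReal.ofReal_mul (by positivity), ← ENNReal.ofReal_mul (by positivity),
    ENNReal.ofReal_rpow_of_pos hv0, ← ENNReal.ofReal_pow hA.le, ← ENNReal.ofReal_mul (by positivity),
    show (2 : ENNReal) = ENNReal.ofReal 2 by simp, ← ENNReal.ofReal_mul (by norm_num),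
    ← ENNReal.ofReal_mul (by norm_num), ← ENNReal.ofReal_add (by positivity) (by positivity),
    ENNReal.ofReal_le_ofReal_iff (by positivity), ← sq_abs, ← ht] at key
  have hv1 : v ^ (2 * s / (N : ℝ)) = v / (2 * A / t) ^ 2 := by
    rw [hps, Real.rpow_sub hv0, Real.rpow_one, hv, ← Real.rpow_mul (by positivity),
      mul_div_cancel₀ _ hp.ne']
    norm_num
  have hv2 : 2 * (A ^ 2 * v ^ (2 * s / (N : ℝ))) = t ^ 2 * v / 2 := by
    rw [hv1]; field_simp
  have hRv : R ^ ((N : ℝ) + 2 * s) = v * v ^ (2 * s / (N : ℝ)) * (ω⁻¹) ^ (1 + 2 * s / (N : ℝ)) := by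
    rw [hR, ← Real.rpow_mul (by positivity), show 1 / (N : ℝ) * (N + 2 * s) = 1 + 2 * s / N by
      field_simp, div_eq_mul_inv, Real.mul_rpow hv0.le (by positivity), Real.rpow_add hv0,
      Real.rpow_one]
  rw [hv2, hRv] at key
  have hkey : t ^ 2 ≤ 4 * (v ^ (2 * s / (N : ℝ)) * (ω⁻¹) ^ (1 + 2 * s / (N : ℝ)) * G) := by
    refine le_of_mul_le_mul_right ?_ hv0
    nlinarith
  have hv3 : v ^ (2 * s / (N : ℝ)) = 2 ^ (p - 2) * A ^ (p - 2) / t ^ (p - 2) := by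
    rw [hv, ← Real.rpow_mul (by positivity), hps, mul_sub, mul_one, mul_div_cancel₀ _ hp.ne',
      Real.div_rpow (by positivity) ht0.le, Real.mul_rpow (by norm_num) hA.le]
  rw [hGe, ← ENNReal.ofReal_mul (by positivity)]
  refine ENNReal.ofReal_le_ofReal ?_
  have htp : t ^ p = t ^ 2 * t ^ (p - 2) := by
    rw [← Real.rpow_natCast t 2, ← Real.rpow_add ht0]; congr 1; push_cast; ring
  rw [htp]
  calc t ^ 2 * t ^ (p - 2)
      ≤ 4 * (v ^ (2 * s / (N : ℝ)) * (ω⁻¹) ^ (1 + 2 * s / (N : ℝ)) * G) * t ^ (p - 2) := by gcongr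
    _ = _ := by
        rw [hv3]
        have : 0 < t ^ (p - 2) := by positivity
        field_simp

/-- The fractional Sobolev inequality. -/
theorem exists_sobolev_const (N : ℕ) (s : ℝ) (hs0 : 0 < s) (hN : 2 * s < (N : ℝ)) :
    ∃ C : ℝ, 0 < C ∧ ∀ u : RN N → ℝ, MemDs N s u →
      (eLpNorm u (ENNReal.ofReal (critExp N s)) volume).toReal ^ 2 ≤ C * gagliardoForm N s u u := by
  obtain ⟨C, hC, h⟩ := exists_abs_rpow_critExp_le N s hs0 hN
  refine ⟨C, hC, fun u hu => ?_⟩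
  have hE : 0 ≤ gagliardoForm N s u u :=
    integral_nonneg fun p => div_nonneg (mul_self_nonneg _) (by positivity)
  have hp : 0 < critExp N s := critExp_pos hs0 hN
  -- The pointwise bound and the final division by `A ^ (p - 2)` both need a nonzero norm.
  rcases (ENNReal.toReal_nonneg (a := eLpNorm u (ENNReal.ofReal (critExp N s)) volume)).eq_or_lt'
    with hA | hA
  · rw [hA]
    simp only [ne_eq, OfNat.ofNat_ne_zero, not_false_eq_true, zero_pow]
    positivity
  have hx := h u hu.1 hA
  set A := (eLpNorm u (ENNReal.ofReal (critExp N s)) volume).toReal with hAdef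
  have h1 : ENNReal.ofReal (A ^ critExp N s) = ∫⁻ x, ENNReal.ofReal (|u x| ^ critExp N s) := by
    rw [← ENNReal.ofReal_rpow_of_pos hA, hAdef, ENNReal.ofReal_toReal hu.1.2.ne,
      eLpNorm_eq_lintegral_rpow_enorm_toReal (by simpa using hp) (by simp), ← ENNReal.rpow_mul,
      ENNReal.toReal_ofReal hp.le, one_div_mul_cancel hp.ne', ENNReal.rpow_one]
    refine lintegral_congr fun x => ?_
    rw [Real.enorm_eq_ofReal_abs, ENNReal.ofReal_rpow_of_nonneg (abs_nonneg _) hp.le]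
  have h2 : ENNReal.ofReal (A ^ critExp N s) ≤
      ENNReal.ofReal (C * A ^ (critExp N s - 2) * gagliardoForm N s u u) := by
    rw [h1, ENNReal.ofReal_mul (by positivity), ← lintegral_gagliardoInner hu,
      ← lintegral_const_mul' _ _ ENNReal.ofReal_ne_top]
    exact lintegral_mono hx
  rw [ENNReal.ofReal_le_ofReal_iff (by positivity)] at h2
  have h3 : A ^ critExp N s = A ^ (critExp N s - 2) * A ^ 2 := by
    rw [← Real.rpow_natCast A 2, ← Real.rpow_add hA]; congr 1; push_cast; ring
  refine le_of_mul_le_mul_left ?_ (show 0 < A ^ (critExp N s - 2) by positivity)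
  rw [← h3]
  linarith

/-! ### The De Giorgi iteration for real sequences -/

/-- With ratio `b = 2^(-1/η)` one has `b^η = 1/2`, so the superlinear gain `(b^n)^η` cancels the
growth `2^n`. The smallness of `a 0` then propagates `a n ≤ a 0 * b^n`. -/
theorem tendsto_zero_of_geometric_superlinear {a : ℕ → ℝ} {D η : ℝ} (hD : 0 < D) (hη : 0 < η)
    (ha : ∀ n, 0 ≤ a n) (hrec : ∀ n, a (n + 1) ≤ D * 2 ^ n * a n ^ (1 + η))
    (h0 : D * a 0 ^ η ≤ 2 ^ (-(1 / η))) : Tendsto a atTop (𝓝 0) := by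
  set b : ℝ := 2 ^ (-(1 / η)) with hb
  have hb0 : 0 < b := by positivity
  have hb1 : b < 1 := Real.rpow_lt_one_of_one_lt_of_neg (by norm_num) (by simp [hη])
  have hbη : b ^ η = 2⁻¹ := by
    rw [hb, ← Real.rpow_mul (by norm_num)]
    rw [neg_mul, one_div_mul_cancel hη.ne', Real.rpow_neg_one]
  have key : ∀ n, a n ≤ a 0 * b ^ n := by
    intro n
    induction n with
    | zero => simp
    | succ n ih =>
      have h1 : a n ^ (1 + η) ≤ (a 0 * b ^ n) ^ (1 + η) :=
        Real.rpow_le_rpow (ha n) ih (by positivity)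
      have h2 : (a 0 * b ^ n) ^ (1 + η) = a 0 * a 0 ^ η * (b ^ n * (2⁻¹) ^ n) := by
        rw [Real.mul_rpow (ha 0) (by positivity), Real.rpow_add_of_nonneg (ha 0) zero_le_one hη.le,
          Real.rpow_one, Real.rpow_add (by positivity), Real.rpow_one, ← hbη,
          ← Real.rpow_natCast b n, ← Real.rpow_natCast (b ^ η) n, ← Real.rpow_mul hb0.le,
          ← Real.rpow_mul hb0.le, mul_comm η]
      calc a (n + 1) ≤ D * 2 ^ n * (a 0 * a 0 ^ η * (b ^ n * (2⁻¹) ^ n)) := by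
            refine (hrec n).trans ?_
            rw [← h2]; gcongr
        _ = (D * a 0 ^ η) * (a 0 * b ^ n) * (2 ^ n * (2⁻¹) ^ n) := by ring
        _ = (D * a 0 ^ η) * (a 0 * b ^ n) := by rw [← mul_pow]; norm_num
        _ ≤ b * (a 0 * b ^ n) := by
            have := ha 0
            gcongr
        _ = a 0 * b ^ (n + 1) := by ring
  refine squeeze_zero ha key ?_
  simpa using (tendsto_pow_atTop_nhds_zero_of_lt_one hb0.le hb1).const_mul (a 0)

theorem exists_level_eq_zero {U : ℝ → ℝ} {D η : ℝ} (hD : 0 < D) (hη : 0 < η)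
    (hU : ∀ k, 0 ≤ U k) (hanti : Antitone U) (hsmall : ∀ ε > 0, ∃ k > 0, U k ≤ ε)
    (hstep : ∀ k h, 0 < k → k < h → U k ≤ 1 → (h - k) * U h ≤ h * (D * U k ^ (1 + η))) :
    ∃ K, 0 < K ∧ U K = 0 := by
  obtain ⟨ε, hε0, hε1, hε⟩ : ∃ ε : ℝ, 0 < ε ∧ ε ≤ 1 ∧ 4 * D * ε ^ η ≤ 2 ^ (-(1 / η)) := by
    have ht : Tendsto (fun x : ℝ => 4 * D * x ^ η) (𝓝[>] 0) (𝓝 0) := by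
      have : ContinuousAt (fun x : ℝ => 4 * D * x ^ η) 0 :=
        continuousAt_const.mul (Real.continuousAt_rpow_const _ _ (Or.inr hη.le))
      have h := this.tendsto
      simp only [Real.zero_rpow hη.ne', mul_zero] at h
      exact h.mono_left nhdsWithin_le_nhds
    have h1 := ht.eventually (eventually_le_nhds (b := (2 : ℝ) ^ (-(1 / η))) (by positivity))
    have h2 : ∀ᶠ x : ℝ in 𝓝[>] 0, x ∈ Set.Ioc (0 : ℝ) 1 :=
      Ioc_mem_nhdsGT one_pos
    obtain ⟨x, hx, hx'⟩ := (h1.and h2).exists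
    exact ⟨x, hx'.1, hx'.2, hx⟩
  obtain ⟨K, hK, hUK⟩ := hsmall ε hε0
  refine ⟨2 * K, by positivity, ?_⟩
  -- The levels increase from `K` to `2K` with gaps `K * 2^(-n-1)`, so `h / (h - k)` is at most `4 *
  -- 2^n`; this is the origin of the factor `4 * D` in the smallness condition.
  set k : ℕ → ℝ := fun n => K * (2 - (2⁻¹) ^ n) with hk
  have hpow : ∀ n : ℕ, (0 : ℝ) < (2⁻¹) ^ n ∧ ((2⁻¹ : ℝ)) ^ n ≤ 1 := fun n =>
    ⟨by positivity, pow_le_one₀ (by norm_num) (by norm_num)⟩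
  have hkK : ∀ n, K ≤ k n := fun n => by
    have := (hpow n).2
    simp only [hk]; nlinarith
  have hk2 : ∀ n, k n ≤ 2 * K := fun n => by
    have := (hpow n).1
    simp only [hk]; nlinarith
  have hlim : Tendsto (fun n => U (k n)) atTop (𝓝 0) := by
    refine tendsto_zero_of_geometric_superlinear (D := 4 * D) (by positivity) hη (fun n => hU _) ?_ ?_
    · intro n
      have hdiff : k (n + 1) - k n = K * ((2⁻¹) ^ n * 2⁻¹) := by
        simp only [hk, pow_succ]; ring
      have hlt : k n < k (n + 1) := by
        have : 0 < K * ((2⁻¹ : ℝ) ^ n * 2⁻¹) := by positivity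
        linarith
      have h1 := hstep (k n) (k (n + 1)) (hK.trans_le (hkK n)) hlt
        ((hanti (hkK n)).trans (hUK.trans hε1))
      rw [hdiff] at h1
      have hX : 0 ≤ D * U (k n) ^ (1 + η) := mul_nonneg hD.le (Real.rpow_nonneg (hU _) _)
      have h2 := h1.trans (mul_le_mul_of_nonneg_right (hk2 (n + 1)) hX)
      have h3 : ((2⁻¹ : ℝ)) ^ n * 2 ^ n = 1 := by rw [← mul_pow]; norm_num
      have h4 : (2⁻¹ : ℝ) ^ n * U (k (n + 1)) ≤ 4 * (D * U (k n) ^ (1 + η)) := by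
        refine le_of_mul_le_mul_left ?_ (show 0 < K * 2⁻¹ by positivity)
        linarith
      calc U (k (n + 1)) = ((2⁻¹ : ℝ) ^ n * U (k (n + 1))) * 2 ^ n := by
            rw [mul_right_comm, h3, one_mul]
        _ ≤ 4 * (D * U (k n) ^ (1 + η)) * 2 ^ n := by gcongr
        _ = 4 * D * 2 ^ n * U (k n) ^ (1 + η) := by ring
    · have : k 0 = K := by simp only [hk]; norm_num
      rw [this]
      refine le_trans ?_ hε
      have := hU K
      gcongr
  refine le_antisymm (ge_of_tendsto hlim (Eventually.of_forall fun n => hanti (hk2 n))) (hU _)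

/-! ### Truncations -/

/-- `t` minus its projection to `[-k, k]`. -/
noncomputable def softThreshold (k t : ℝ) : ℝ := t - max (-k) (min k t)

/-- `t` if `k < |t|`, and `0` otherwise. -/
noncomputable def hardThreshold (k t : ℝ) : ℝ := if k < |t| then t else 0

theorem continuous_softThreshold (k : ℝ) : Continuous (softThreshold k) := by
  unfold softThreshold; fun_prop

theorem measurable_hardThreshold (k : ℝ) : Measurable (hardThreshold k) := by
  unfold hardThreshold
  exact Measurable.ite (measurableSet_lt measurable_const measurable_id.abs) measurable_id
    measurable_const

/-- The projection to `[-k, k]` and its complement are both nondecreasing, so their increments have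
nonnegative product, which is the difference of the two sides. -/
theorem sq_softThreshold_sub_le {k : ℝ} (hk : 0 ≤ k) (a b : ℝ) :
    (softThreshold k a - softThreshold k b) ^ 2 ≤
      (a - b) * (softThreshold k a - softThreshold k b) := by
  unfold softThreshold
  rcases le_total k a with h1 | h1 <;> rcases le_total k b with h2 | h2 <;>
    rcases le_total (-k) a with h3 | h3 <;> rcases le_total (-k) b with h4 | h4 <;>
    simp only [min_eq_left, min_eq_right, max_eq_left, max_eq_right, *,
      neg_le_self hk] <;> nlinarith

theorem abs_le_abs_of_sq_le_mul {a d : ℝ} (h : d ^ 2 ≤ a * d) : |d| ≤ |a| := by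
  rcases eq_or_ne d 0 with rfl | hd
  · simp
  · have h1 : |d| * |d| ≤ |a| * |d| := by
      rw [abs_mul_abs_self, ← abs_mul, ← sq]; exact h.trans (le_abs_self _)
    exact le_of_mul_le_mul_right h1 (abs_pos.mpr hd)

theorem softThreshold_zero {k : ℝ} (hk : 0 ≤ k) : softThreshold k 0 = 0 := by
  simp [softThreshold, hk]

theorem abs_softThreshold_le_abs {k : ℝ} (hk : 0 ≤ k) (t : ℝ) : |softThreshold k t| ≤ |t| := by
  have := abs_le_abs_of_sq_le_mul (sq_softThreshold_sub_le hk t 0)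
  simpa [softThreshold_zero hk] using this

theorem softThreshold_eq_zero {k t : ℝ} (h : |t| ≤ k) : softThreshold k t = 0 := by
  obtain ⟨h1, h2⟩ := abs_le.mp h
  simp [softThreshold, h1, h2]

/-- For `|t| > h > 0`, the ratio `1 - k/|t|` is at least `1 - k/h`. This converts a bound at level
`k` into one at the higher level `h`. -/
theorem sub_mul_abs_hardThreshold_le {k h : ℝ} (hk : 0 ≤ k) (hkh : k ≤ h) (t : ℝ) :
    (h - k) * |hardThreshold h t| ≤ h * |softThreshold k t| := by
  unfold hardThreshold
  split_ifs with ht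
  · have h1 : |t| - k ≤ |softThreshold k t| := by
      have h2 : |max (-k) (min k t)| ≤ k :=
        abs_le.mpr ⟨le_max_left _ _, max_le (by linarith) (min_le_left _ _)⟩
      have := abs_sub_abs_le_abs_sub t (max (-k) (min k t))
      unfold softThreshold
      linarith
    have h3 : (h - k) * |t| ≤ h * (|t| - k) := by nlinarith
    exact h3.trans (mul_le_mul_of_nonneg_left h1 (hk.trans hkh))
  · simp only [abs_zero, mul_zero]
    exact mul_nonneg (hk.trans hkh) (abs_nonneg _)

theorem abs_hardThreshold_anti {k h : ℝ} (hkh : k ≤ h) (t : ℝ) :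
    |hardThreshold h t| ≤ |hardThreshold k t| := by
  unfold hardThreshold
  split_ifs with h1 h2
  · exact le_rfl
  · exact absurd (hkh.trans_lt h1) h2
  · simp
  · simp

/-! ### Interpolation and Hölder estimates -/

theorem memLp_of_le_of_le {α : Type*} {m0 : MeasurableSpace α} {μ : Measure α} {f : α → ℝ}
    {a b c : ℝ} (ha : 0 < a) (hab : a ≤ b) (hbc : b ≤ c)
    (hfa : MemLp f (ENNReal.ofReal a) μ) (hfc : MemLp f (ENNReal.ofReal c) μ) :
    MemLp f (ENNReal.ofReal b) μ := by
  have hb : 0 < b := ha.trans_le hab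
  have hc : 0 < c := hb.trans_le hbc
  have aux : ∀ {t : ℝ}, 0 < t → (Integrable (fun x => ‖f x‖ ^ t) μ ↔ MemLp f (ENNReal.ofReal t) μ) := by
    intro t ht
    have := integrable_norm_rpow_iff hfa.1 (p := ENNReal.ofReal t) (by simpa using ht) (by simp)
    rwa [ENNReal.toReal_ofReal ht.le] at this
  rw [← aux hb]
  refine (((aux ha).mpr hfa).add ((aux hc).mpr hfc)).mono'
    ((hfa.1.norm.aemeasurable.pow_const b).aestronglyMeasurable) (ae_of_all _ fun x => ?_)
  rw [Real.norm_of_nonneg (by positivity)]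
  simp only [Pi.add_apply]
  -- The `b`-th power is dominated by the `a`-th where `‖f x‖ ≤ 1` and by the `c`-th elsewhere.
  rcases le_total ‖f x‖ 1 with h | h
  · rcases (norm_nonneg (f x)).eq_or_lt' with h0 | h0
    · rw [h0, Real.zero_rpow hb.ne']; positivity
    · have := Real.rpow_le_rpow_of_exponent_ge h0 h hab
      have h' : 0 ≤ ‖f x‖ ^ c := by positivity
      linarith
  · have := Real.rpow_le_rpow_of_exponent_le h hbc
    have h' : 0 ≤ ‖f x‖ ^ a := by positivity
    linarith

theorem memLp_of_bound_of_le {α : Type*} {m0 : MeasurableSpace α} {μ : Measure α} {f : α → ℝ}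
    {p K : ℝ} (hp : 0 < p) (hf : MemLp f (ENNReal.ofReal p) μ) (hK : ∀ᵐ x ∂μ, |f x| ≤ K)
    {σ : ENNReal} (hσ : ENNReal.ofReal p ≤ σ) : MemLp f σ μ := by
  rcases eq_or_ne σ ⊤ with rfl | hσt
  · exact memLp_top_of_bound hf.1 K hK
  have hpσ : p ≤ σ.toReal := (ENNReal.ofReal_le_iff_le_toReal hσt).mp hσ
  have hσ0 : σ ≠ 0 := by
    rintro rfl
    simp at hpσ; linarith
  rw [← integrable_norm_rpow_iff hf.1 hσ0 hσt]
  have h1 := (integrable_norm_rpow_iff hf.1 (by simpa using hp) (by simp)).mpr hf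
  rw [ENNReal.toReal_ofReal hp.le] at h1
  refine (h1.const_mul (|K| ^ (σ.toReal - p))).mono'
    ((hf.1.norm.aemeasurable.pow_const _).aestronglyMeasurable) (hK.mono fun x hx => ?_)
  rw [Real.norm_of_nonneg (by positivity)]
  have hx' : ‖f x‖ ≤ |K| := hx.trans (le_abs_self K)
  calc ‖f x‖ ^ σ.toReal = ‖f x‖ ^ (σ.toReal - p) * ‖f x‖ ^ p := by
        rw [← Real.rpow_add_of_nonneg (norm_nonneg _) (by linarith) hp.le, sub_add_cancel]
    _ ≤ |K| ^ (σ.toReal - p) * ‖f x‖ ^ p := by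
        have : 0 ≤ σ.toReal - p := by linarith
        gcongr

/-- Three-factor Hölder: `1/a + (q - 1)/p + 1/p = 1`. Taking `a` in `ENNReal` admits `a = ⊤`, the
bounded weight of the critical case. -/
theorem lintegral_mul_rpow_mul_le {α : Type*} {m0 : MeasurableSpace α} {μ : Measure α}
    {m v φ : α → ℝ} {p q : ℝ} {a : ENNReal} (hp : 0 < p) (hq : 1 < q)
    (ha : a⁻¹ + ENNReal.ofReal (q / p) = 1)
    (hm : AEStronglyMeasurable m μ) (hv : AEStronglyMeasurable v μ)
    (hφ : AEStronglyMeasurable φ μ) :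
    ∫⁻ x, ‖m x * |v x| ^ (q - 1) * φ x‖ₑ ∂μ ≤
      eLpNorm m a μ * eLpNorm v (ENNReal.ofReal p) μ ^ (q - 1) * eLpNorm φ (ENNReal.ofReal p) μ := by
  have hq1 : 0 < q - 1 := by linarith
  have inv_ofReal : ∀ {t : ℝ}, 0 < t → (ENNReal.ofReal t)⁻¹ = ENNReal.ofReal t⁻¹ :=
    fun ht => (ENNReal.ofReal_inv_of_pos ht).symm
  have h1 : ENNReal.HolderTriple (ENNReal.ofReal (p / (q - 1))) (ENNReal.ofReal p)
      (ENNReal.ofReal (p / q)) := ⟨by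
    rw [inv_ofReal (by positivity), inv_ofReal hp, inv_ofReal (by positivity),
      ← ENNReal.ofReal_add (by positivity) (by positivity)]
    congr 1
    field_simp
    ring⟩
  have h2 : ENNReal.HolderTriple a (ENNReal.ofReal (p / q)) 1 := ⟨by
    rw [inv_ofReal (by positivity), inv_div, ha, inv_one]⟩
  have hw : AEStronglyMeasurable (fun x => ‖v x‖ ^ (q - 1)) μ :=
    (hv.norm.aemeasurable.pow_const _).aestronglyMeasurable
  have e1 := eLpNorm_smul_le_mul_eLpNorm (hw.smul hφ) hm (p := a) (q := ENNReal.ofReal (p / q))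
    (r := 1)
  have e2 := eLpNorm_smul_le_mul_eLpNorm hφ hw (p := ENNReal.ofReal (p / (q - 1)))
    (q := ENNReal.ofReal p) (r := ENNReal.ofReal (p / q))
  rw [eLpNorm_norm_rpow v hq1, ← ENNReal.ofReal_mul (by positivity), div_mul_cancel₀ _ hq1.ne'] at e2
  rw [eLpNorm_one_eq_lintegral_enorm] at e1
  refine le_trans (le_of_eq ?_) (e1.trans ?_)
  · refine lintegral_congr fun x => ?_
    simp [mul_assoc]
  · rw [mul_assoc]
    gcongr

theorem exists_eLpNorm_hardThreshold_le {α : Type*} {m0 : MeasurableSpace α} {μ : Measure α}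
    {u : α → ℝ} {P : ENNReal} (hu : MemLp u P μ) {ε : ℝ} (hε : 0 < ε) :
    ∃ k > 0, eLpNorm (fun x => hardThreshold k (u x)) P μ ≤ ENNReal.ofReal ε := by
  have hmk : MemLp (hu.1.mk u) P μ := hu.ae_eq hu.1.ae_eq_mk
  obtain ⟨M, hM⟩ := hmk.eLpNorm_indicator_norm_ge_le hu.1.stronglyMeasurable_mk hε
  refine ⟨max M 1, by positivity, le_trans (eLpNorm_mono_ae ?_) hM⟩
  filter_upwards [hu.1.ae_eq_mk] with x hx
  rw [hx]
  unfold hardThreshold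
  split_ifs with h
  · rw [Set.indicator_of_mem]
    simp only [Set.mem_ofPred_eq, coe_nnnorm, Real.norm_eq_abs]
    exact (le_max_left _ _).trans h.le
  · simp

/-! ### Testing the equation with truncations -/

theorem MemDs.softThreshold_comp {N : ℕ} {s k : ℝ} {u : RN N → ℝ} (hu : MemDs N s u) (hk : 0 ≤ k) :
    MemDs N s (fun x => softThreshold k (u x)) :=
  memDs_of_abs_sub_le hu ((continuous_softThreshold k).comp_aestronglyMeasurable hu.1.1)
    (fun _ => abs_softThreshold_le_abs hk _)
    fun _ _ => abs_le_abs_of_sq_le_mul (sq_softThreshold_sub_le hk _ _)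

theorem aestronglyMeasurable_hardThreshold {N : ℕ} {u : RN N → ℝ}
    (hu : AEStronglyMeasurable u volume) (k : ℝ) :
    AEStronglyMeasurable (fun x => hardThreshold k (u x)) volume :=
  ((measurable_hardThreshold k).comp_aemeasurable hu.aemeasurable).aestronglyMeasurable

theorem abs_hardThreshold_le_abs (k t : ℝ) : |hardThreshold k t| ≤ |t| := by
  unfold hardThreshold
  split_ifs
  · exact le_rfl
  · simp

theorem memLp_hardThreshold {N : ℕ} {u : RN N → ℝ} {P : ENNReal} (hu : MemLp u P volume) (k : ℝ) :
    MemLp (fun x => hardThreshold k (u x)) P volume :=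
  hu.mono (aestronglyMeasurable_hardThreshold hu.1 k)
    (ae_of_all _ fun _ => abs_hardThreshold_le_abs _ _)

/-- The soft threshold vanishes where `|u| ≤ k`, and elsewhere `u` equals its hard threshold.
Hölder's inequality therefore sees only the tail of `u`. -/
theorem integral_mul_softThreshold_le {N : ℕ} {p q r k : ℝ} (hp : 0 < p) (hk : 0 ≤ k) (hq : 1 < q)
    (hr : 1 < r) {u m h w : RN N → ℝ} {a b : ENNReal}
    (hu : MemLp u (ENNReal.ofReal p) volume)
    (ha : a⁻¹ + ENNReal.ofReal (q / p) = 1) (hb : b⁻¹ + ENNReal.ofReal (r / p) = 1)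
    (hm : MemLp m a volume) (hh : MemLp h b volume)
    (hw : ∀ᵐ x, |w x| ≤ m x * |u x| ^ (q - 1) + h x * |u x| ^ (r - 1)) :
    ∫ x, w x * softThreshold k (u x) ≤
      ((eLpNorm m a volume).toReal *
          (eLpNorm (fun x => hardThreshold k (u x)) (ENNReal.ofReal p) volume).toReal ^ (q - 1) +
        (eLpNorm h b volume).toReal *
          (eLpNorm (fun x => hardThreshold k (u x)) (ENNReal.ofReal p) volume).toReal ^ (r - 1)) *
      (eLpNorm (fun x => softThreshold k (u x)) (ENNReal.ofReal p) volume).toReal := by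
  set v : RN N → ℝ := fun x => hardThreshold k (u x) with hv
  set φ : RN N → ℝ := fun x => softThreshold k (u x) with hφ
  have hvL : MemLp v (ENNReal.ofReal p) volume := memLp_hardThreshold hu k
  have hφL : MemLp φ (ENNReal.ofReal p) volume :=
    hu.mono ((continuous_softThreshold k).comp_aestronglyMeasurable hu.1)
      (ae_of_all _ fun _ => abs_softThreshold_le_abs hk _)
  have h1 := lintegral_mul_rpow_mul_le hp hq ha hm.1 hvL.1 hφL.1
  have h2 := lintegral_mul_rpow_mul_le hp hr hb hh.1 hvL.1 hφL.1
  have hq1 : 0 ≤ q - 1 := by linarith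
  have hr1 : 0 ≤ r - 1 := by linarith
  have hle : ∫⁻ x, ‖w x * φ x‖ₑ ≤
      (∫⁻ x, ‖m x * |v x| ^ (q - 1) * φ x‖ₑ) + ∫⁻ x, ‖h x * |v x| ^ (r - 1) * φ x‖ₑ := by
    rw [← lintegral_add_left']
    · refine lintegral_mono_ae (hw.mono fun x hx => ?_)
      rcases le_or_gt |u x| k with hux | hux
      · simp [hφ, softThreshold_eq_zero hux]
      · have hvx : v x = u x := by simp [hv, hardThreshold, hux]
        rw [hvx, ← enorm_norm (m x * _ * _), ← enorm_norm (h x * _ * _),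
          Real.enorm_of_nonneg (norm_nonneg _), Real.enorm_of_nonneg (norm_nonneg _),
          ← ENNReal.ofReal_add (norm_nonneg _) (norm_nonneg _), Real.enorm_eq_ofReal_abs]
        refine ENNReal.ofReal_le_ofReal ?_
        rw [abs_mul, norm_mul, norm_mul (h x * _), ← add_mul]
        exact mul_le_mul_of_nonneg_right
          (hx.trans (add_le_add (le_abs_self _) (le_abs_self _))) (abs_nonneg _)
    · exact ((hm.1.mul (hvL.1.norm.aemeasurable.pow_const _).aestronglyMeasurable).mul hφL.1).enorm
  have hfin : eLpNorm m a volume * eLpNorm v (ENNReal.ofReal p) volume ^ (q - 1) *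
        eLpNorm φ (ENNReal.ofReal p) volume +
      eLpNorm h b volume * eLpNorm v (ENNReal.ofReal p) volume ^ (r - 1) *
        eLpNorm φ (ENNReal.ofReal p) volume ≠ ⊤ :=
    ENNReal.add_ne_top.mpr
      ⟨ENNReal.mul_ne_top (ENNReal.mul_ne_top hm.2.ne
          (ENNReal.rpow_ne_top_of_nonneg hq1 hvL.2.ne)) hφL.2.ne,
        ENNReal.mul_ne_top (ENNReal.mul_ne_top hh.2.ne
          (ENNReal.rpow_ne_top_of_nonneg hr1 hvL.2.ne)) hφL.2.ne⟩
  have h3 := ENNReal.toReal_mono hfin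
    ((enorm_integral_le_lintegral_enorm (fun x => w x * φ x)).trans (hle.trans (add_le_add h1 h2)))
  rw [ENNReal.toReal_add (ENNReal.add_ne_top.mp hfin).1 (ENNReal.add_ne_top.mp hfin).2] at h3
  simp only [ENNReal.toReal_mul, ← ENNReal.toReal_rpow, toReal_enorm] at h3
  rw [add_mul]
  exact (le_abs_self _).trans h3

/-- Weak solutions with superlinear, at most critical growth are bounded. -/
theorem IsWeakSolution.exists_ae_abs_le {N : ℕ} {s q r : ℝ} (hs0 : 0 < s) (hN : 2 * s < (N : ℝ))
    (hq : 2 < q) (hqr : q ≤ r) {κ : RN N → ℝ → ℝ} {u m h : RN N → ℝ} {a b : ENNReal}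
    (ha : a⁻¹ + ENNReal.ofReal (q / critExp N s) = 1)
    (hb : b⁻¹ + ENNReal.ofReal (r / critExp N s) = 1)
    (hm : MemLp m a volume) (hh : MemLp h b volume)
    (hκ : ∀ᵐ x, ∀ t, |κ x t| ≤ m x * |t| ^ (q - 1) + h x * |t| ^ (r - 1))
    (hu : IsWeakSolution N s κ u) : ∃ K, ∀ᵐ x, |u x| ≤ K := by
  obtain ⟨S, hS, hsob⟩ := exists_sobolev_const N s hs0 hN
  have hp := critExp_pos hs0 hN
  set P := ENNReal.ofReal (critExp N s) with hP
  set M₁ := (eLpNorm m a volume).toReal with hM₁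
  set M₂ := (eLpNorm h b volume).toReal with hM₂
  have hM₁0 : 0 ≤ M₁ := ENNReal.toReal_nonneg
  have hM₂0 : 0 ≤ M₂ := ENNReal.toReal_nonneg
  set U : ℝ → ℝ := fun k => (eLpNorm (fun x => hardThreshold k (u x)) P volume).toReal with hUdef
  have hUL : ∀ k, MemLp (fun x => hardThreshold k (u x)) P volume := memLp_hardThreshold hu.1.1
  have hU0 : ∀ k, 0 ≤ U k := fun k => ENNReal.toReal_nonneg
  -- Sobolev, the equation and Hölder give `B^2 ≤ S (M₁ + M₂) U^(q-1) B`, where `U ≤ 1` lets the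
  -- power `q - 1` dominate `r - 1`. The added `1` only keeps the constant positive.
  have hsoft : ∀ k, 0 < k → U k ≤ 1 →
      (eLpNorm (fun x => softThreshold k (u x)) P volume).toReal ≤
        (S * (M₁ + M₂) + 1) * U k ^ (1 + (q - 2)) := by
    intro k hk hUk
    have hφ := hu.1.softThreshold_comp hk.le
    have h1 := hsob _ hφ
    have h2 := gagliardoForm_self_le hu.1 hφ fun x y => sq_softThreshold_sub_le hk.le (u x) (u y)
    have h3 := integral_mul_softThreshold_le hp hk.le (by linarith) (by linarith) hu.1.1 ha hb hm hh
      (hκ.mono fun x hx => hx (u x))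
    rw [hu.2 _ hφ] at h2
    set B := (eLpNorm (fun x => softThreshold k (u x)) P volume).toReal with hB
    have hB0 : 0 ≤ B := ENNReal.toReal_nonneg
    rw [show (1 : ℝ) + (q - 2) = q - 1 by ring]
    have h4 : U k ^ (r - 1) ≤ U k ^ (q - 1) := by
      rcases (hU0 k).eq_or_lt' with h0 | h0
      · rw [h0, Real.zero_rpow (by linarith), Real.zero_rpow (by linarith)]
      · exact Real.rpow_le_rpow_of_exponent_ge h0 hUk (by linarith)
    have hX : 0 ≤ U k ^ (q - 1) := Real.rpow_nonneg (hU0 k) _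
    have h5 : B * B ≤ (S * (M₁ + M₂) * U k ^ (q - 1)) * B := by
      calc B * B ≤ S * ((M₁ * U k ^ (q - 1) + M₂ * U k ^ (r - 1)) * B) := by
            rw [← sq]
            exact h1.trans (mul_le_mul_of_nonneg_left (h2.trans h3) hS.le)
        _ ≤ S * ((M₁ * U k ^ (q - 1) + M₂ * U k ^ (q - 1)) * B) := by gcongr
        _ = _ := by ring
    rcases hB0.eq_or_lt' with h0 | h0
    · rw [h0]; positivity
    · have := le_of_mul_le_mul_right h5 h0
      linarith
  obtain ⟨K, hK, hUK⟩ : ∃ K, 0 < K ∧ U K = 0 := by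
    refine exists_level_eq_zero (D := S * (M₁ + M₂) + 1) (η := q - 2) (by positivity)
      (by linarith) hU0 ?_ ?_ ?_
    · intro k h hkh
      exact ENNReal.toReal_mono (hUL k).2.ne
        (eLpNorm_mono fun x => abs_hardThreshold_anti hkh (u x))
    · intro ε hε
      obtain ⟨k, hk, hle⟩ := exists_eLpNorm_hardThreshold_le hu.1.1 hε
      exact ⟨k, hk, ENNReal.toReal_le_of_le_ofReal hε.le hle⟩
    · intro k l hk hkl hUk
      refine le_trans ?_ (mul_le_mul_of_nonneg_left (hsoft k hk hUk) (hk.trans hkl).le)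
      have h1 := eLpNorm_le_mul_eLpNorm_of_ae_le_mul (p := P) (μ := volume) (c := l / (l - k))
        (f := fun x => hardThreshold l (u x)) (g := fun x => softThreshold k (u x))
        (ae_of_all _ fun x => by
          have := sub_mul_abs_hardThreshold_le hk.le hkl.le (u x)
          rw [Real.norm_eq_abs, Real.norm_eq_abs, div_mul_eq_mul_div,
            le_div_iff₀ (sub_pos.mpr hkl)]
          linarith)
      have hφ := hu.1.softThreshold_comp hk.le
      have h2 := ENNReal.toReal_mono (ENNReal.mul_ne_top ENNReal.ofReal_ne_top hφ.1.2.ne) h1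
      have hlk : 0 < l - k := sub_pos.mpr hkl
      rw [ENNReal.toReal_mul, ENNReal.toReal_ofReal (by have := hk.trans hkl; positivity),
        div_mul_eq_mul_div, le_div_iff₀ hlk] at h2
      rw [mul_comm]
      exact h2
  refine ⟨K, ?_⟩
  have h0 : eLpNorm (fun x => hardThreshold K (u x)) P volume = 0 :=
    ((ENNReal.toReal_eq_zero_iff _).mp hUK).resolve_right (hUL K).2.ne
  rw [eLpNorm_eq_zero_iff (hUL K).1 (by simpa [hP] using hp)] at h0
  filter_upwards [h0] with x hx
  by_contra! hlt
  simp only [hardThreshold, hlt, if_true, Pi.zero_apply] at hx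
  rw [hx, abs_zero] at hlt
  linarith

/-! ### Weights from the growth conditions -/

theorem inv_ofReal_div_sub_add {p q : ℝ} (hq : 0 < q) (hqp : q < p) :
    (ENNReal.ofReal (p / (p - q)))⁻¹ + ENNReal.ofReal (q / p) = 1 := by
  have h1 : 0 < p - q := by linarith
  have h2 : 0 < p := by linarith
  rw [← ENNReal.ofReal_inv_of_pos (by positivity), ← ENNReal.ofReal_add (by positivity)
    (by positivity), ← ENNReal.ofReal_one]
  congr 1
  field_simp
  ring

/-- The exponent `p/(p - q)` required by Hölder lies between the two given ones, `p/(p - 1)` and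
`p/(p - q) + δ`. -/
theorem GrowthF.exists_weight {N : ℕ} {s q : ℝ} {f : RN N → ℝ → ℝ} (hq : 1 < q)
    (hqp : q < critExp N s) (hf : GrowthF N s q f) :
    ∃ (m : RN N → ℝ) (a : ENNReal), a⁻¹ + ENNReal.ofReal (q / critExp N s) = 1 ∧
      MemLp m a volume ∧ ∀ᵐ x, ∀ t, |f x t| ≤ m x * |t| ^ (q - 1) := by
  obtain ⟨m, -, hm1, ⟨δ, hδ, hm2⟩, hm⟩ := hf
  refine ⟨m, _, inv_ofReal_div_sub_add (by linarith) hqp, ?_, hm⟩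
  have h1 : 0 < critExp N s - q := by linarith
  exact memLp_of_le_of_le (div_pos (by linarith) (by linarith))
    (div_le_div_of_nonneg_left (by linarith) h1 (by linarith)) (by linarith) hm1 hm2

theorem GrowthG.exists_weight {N : ℕ} {s r : ℝ} {g : RN N → ℝ → ℝ} (hs0 : 0 < s)
    (hN : 2 * s < (N : ℝ)) (hg : GrowthG N s r g) :
    ∃ (h : RN N → ℝ) (b : ENNReal), b⁻¹ + ENNReal.ofReal (r / critExp N s) = 1 ∧
      MemLp h b volume ∧ ∀ᵐ x, ∀ t, |g x t| ≤ h x * |t| ^ (r - 1) := by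
  rcases hg with ⟨hr, hrp, h, -, hh, -, hgh⟩ | ⟨rfl, ⟨h, hh, hgh⟩, -⟩
  · exact ⟨h, _, inv_ofReal_div_sub_add (by linarith) hrp, hh, hgh⟩
  · refine ⟨h, ⊤, ?_, hh, hgh⟩
    rw [div_self (critExp_pos hs0 hN).ne']
    simp

end FracLap

theorem mainTheorem5 (N : ℕ) (s q r τ M : ℝ) (hs0 : 0 < s) (hs1 : s < 1) (hN : 2 * s < (N : ℝ))
    (hq2 : 2 < q) (hq : q < min r (FracLap.critExp N s))
    (f g : FracLap.RN N → ℝ → ℝ)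
    (hf : FracLap.IsCaratheodoryFun N f) (hg : FracLap.IsCaratheodoryFun N g)
    (hF : FracLap.GrowthF N s q f) (hG : FracLap.GrowthG N s r g)
    (hτ1 : 1 < τ) (hτ2 : τ < 2)
    (ρ : FracLap.RN N → ℝ) (hρ : ∀ᵐ x ∂(MeasureTheory.volume : MeasureTheory.Measure (FracLap.RN N)), 0 < ρ x)
    (hρL : MeasureTheory.MemLp ρ
      (ENNReal.ofReal (FracLap.critExp N s / (FracLap.critExp N s - τ))) MeasureTheory.volume)
    (hlimsup : FracLap.UniformLimsupLE (FracLap.primitive f) ρ τ M)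
    (hsup : (0 : EReal) < ⨆ v : {v : FracLap.RN N → ℝ // FracLap.MemDs N s v},
      ((∫ x, FracLap.primitive f x (v.1 x) : ℝ) : EReal))
    (lam mu : ℝ) (hlam : 0 < lam) (hmu : 0 ≤ mu)
    (u : FracLap.RN N → ℝ)
    (hu : FracLap.IsWeakSolution N s (fun x t => lam * f x t + mu * g x t) u) :
    ∀ σ : ENNReal, ENNReal.ofReal (FracLap.critExp N s) ≤ σ →
      MeasureTheory.MemLp u σ MeasureTheory.volume := by
  obtain ⟨hqr, hqp⟩ := lt_min_iff.mp hq
  obtain ⟨m, a, ha, hm, hfm⟩ := hF.exists_weight (by linarith) hqp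
  obtain ⟨h, b, hb, hh, hgh⟩ := hG.exists_weight hs0 hN
  -- The coefficients `lam` and `mu` are absorbed into the weights.
  obtain ⟨K, hK⟩ := hu.exists_ae_abs_le hs0 hN hq2 hqr.le ha hb (hm.const_mul lam) (hh.const_mul mu)
    (by
      filter_upwards [hfm, hgh] with x hx hx' t
      refine (abs_add_le _ _).trans ?_
      rw [abs_mul, abs_mul, abs_of_pos hlam, abs_of_nonneg hmu, mul_assoc, mul_assoc]
      exact add_le_add (mul_le_mul_of_nonneg_left (hx t) hlam.le)
        (mul_le_mul_of_nonneg_left (hx' t) hmu))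
  exact fun σ hσ => FracLap.memLp_of_bound_of_le (FracLap.critExp_pos hs0 hN) hu.1.1 hK hσ
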